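/- **Setting.** Let $m\ge 1$. A *problem* on $m$ nodes in dimension $d$ consists of local functions $f_1,\dots,f_m:\mathbb R^d\to\mathbb R$, probability laws $\mathcal D_1,\dots,\mathcal D_m$ and jointly measurable stochastic gradient oracles $g_i(x;\xi)\in\mathbb R^d$; put $f=\frac1m\sum_{i=1}^m f_i$. Given $x^0\in\mathbb R^d$, $\Delta,L>0$ and $\sigma_1,\dots,\sigma_m>0$, the problem is *admissible* if each $f_i$ is differentiable and, for all $i$ and all $x,y$, - $f$ is bounded below and $f(x^0)-\inf f=\Delta$; - $\mathbb E_{\xi\sim\mathcal D_i}[g_i(x;\xi)]=\nabla f_i(x)$ and $\mathbb E_{\xi\sim\mathcal D_i}\|g_i(x;\xi)-\nabla f_i(x)\|^2\le\sigma_i^2$; - $\|\nabla f(x)-\nabla f(y)\|\le L\|x-y\|$ and $\|\nabla f_i(x)-\nabla f_i(y)\|\le mL\|x-y\|$. A *decentralized first-order algorithm* over a graph on the nodes $\{1,\dots,m\}$ fixes an initial point $x^0\in\mathbb R^d$ for every dimension $d$ and produces, on every problem, a (possibly randomized) run as follows. Each node $i$ has a local memory $\mathcal M_{i,t}\subset\mathbb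 R^d$ with $\mathcal M_{i,0}=\{x^0\}$. In step $t\ge1$ node $i$ draws a mini-batch of $B_{i,t}\ge0$ fresh independent samples $\xi_{i,t,1},\dots,\xi_{i,t,B_{i,t}}\sim\mathcal D_i$, independent of the past and of the other nodes' samples of that step, where $B_{i,t}$ is determined by the information available before the step, and $$\mathcal M_{i,t}\subseteq \operatorname{Span}\bigl(\{x,\ g_i(x;\xi_{i,t,j}) : x\in\mathcal M_{i,t-1},\ j\le B_{i,t}\}\bigr)\ \cup\ \operatorname{Span}\Bigl(\bigcup_{j\text{ adjacent to }i}\mathcal M_{j,t-\tau}\Bigr),$$ with communication delays $1\le\tau\le t$ that may depend on $i$ and $t$. At time $t$ node $i$ outputs a vector $x_i^t\in\mathcal M_{i,t}$, which is a random vector determined by the information available at time $t$. The number of samples used up to time $t$ is $N_t=\sum_{s=1}^t\sum_{i=1}^m B_{i,s}$. **Theorem.** Let $\bar\sigma_{\mathrm{AM}}=\frac1m\sum_{i=1}^m\sigma_i$. There are universal constants $c,c_0>0$ such that for every $m\ge1$, every graph on $m$ nodes, every decentralized first-order algorithm over it, all $\Delta,L,\sigma_1,\dots,\sigma_m>0$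 and every $\epsilon>0$ with $\epsilon^2\le c_0\Delta L$, there are a dimension $d$ and an admissible problem in $\mathbb R^d$ (for the algorithm's initial point) on which finding an $\epsilon$-stationary point requires at least order $$\frac{\Delta L\,\bar\sigma_{\mathrm{AM}}^2}{\epsilon^4}+\frac{m\Delta L}{\epsilon^2}$$ samples: whenever the output of some node $i$ at some time $t$ satisfies $\mathbb E\|\nabla f(x_i^t)\|^2\le\epsilon^2$, one has $$\mathbb E[N_t]\ \ge\ c\left(\frac{\Delta L\,\bar\sigma_{\mathrm{AM}}^2}{\epsilon^4}+\frac{m\Delta L}{\epsilon^2}\right).$$ -/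

import Mathlib

open MeasureTheory ProbabilityTheory
open scoped ENNReal Gradient

universe u

/-- The space `ℝ^d` with its Euclidean norm. -/
abbrev Vec (d : ℕ) : Type := EuclideanSpace ℝ (Fin d)

/-- A distributed stochastic problem on `m` nodes in dimension `d`: local functions `f i`, the law
`law i` of the random index drawn at node `i`, and the local stochastic first-order oracles `g i`,
where `g i x z` is the answer at the point `x` when the random index takes the value `z`. -/
structure StochProblem (m d : ℕ) where
  Ξ : Type
  mΞ : MeasurableSpace Ξ
  law : Fin m → Measure Ξ
  law_prob : ∀ i, IsProbabilityMeasure (law i)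
  f : Fin m → Vec d → ℝ
  g : Fin m → Vec d → Ξ → Vec d
  g_meas : ∀ i, Measurable (Function.uncurry (g i))

attribute [instance] StochProblem.mΞ StochProblem.law_prob

namespace StochProblem

variable {m d : ℕ}

/-- The global objective `f = (1/m) ∑ i, f i`. -/
noncomputable def obj (Q : StochProblem m d) (x : Vec d) : ℝ :=
  (1 / (m : ℝ)) * ∑ i, Q.f i x

/-- The standing assumptions on a problem with initial point `x₀`: the global objective is bounded
below with initial optimality gap `Δ`, the stochastic gradients are unbiased with variance at most
`σ i ^ 2` at node `i`, the global objective is `L`-smooth and every local function is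
`m L`-smooth. -/
structure Satisfies (Q : StochProblem m d) (x₀ : Vec d) (Δ L : ℝ) (σ : Fin m → ℝ) : Prop where
  bddBelow : BddBelow (Set.range Q.obj)
  gap : Q.obj x₀ - ⨅ x, Q.obj x = Δ
  differentiable : ∀ i, Differentiable ℝ (Q.f i)
  memLp : ∀ i x, MemLp (Q.g i x) 2 (Q.law i)
  unbiased : ∀ i x, ∫ z, Q.g i x z ∂(Q.law i) = ∇ (Q.f i) x
  variance : ∀ i x, ∫ z, ‖Q.g i x z - ∇ (Q.f i) x‖ ^ 2 ∂(Q.law i) ≤ σ i ^ 2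
  smooth : ∀ x y, ‖∇ Q.obj x - ∇ Q.obj y‖ ^ 2 ≤ L ^ 2 * ‖x - y‖ ^ 2
  smooth_local : ∀ i x y,
    ‖∇ (Q.f i) x - ∇ (Q.f i) y‖ ^ 2 ≤ (m : ℝ) ^ 2 * L ^ 2 * ‖x - y‖ ^ 2

end StochProblem

/-- The computational memory: the span of the points `x` of the previous memory `S` of node `i` and
of the oracle answers `g i x z` at these points, for the random indices `z` drawn in this step
(a mini-batch of `b` of them, possibly none). -/
def compMemory {m d : ℕ} (Q : StochProblem m d) (i : Fin m) (S : Set (Vec d)) (b : ℕ)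
    (z : ℕ → Q.Ξ) : Set (Vec d) :=
  Submodule.span ℝ (S ∪ {v | ∃ x ∈ S, ∃ j < b, v = Q.g i x (z j)})

/-- The communication memory of node `i`: the span of the memories `S j` of its neighbours. -/
def commMemory {m d : ℕ} (G : SimpleGraph (Fin m)) (i : Fin m) (S : Fin m → Set (Vec d)) :
    Set (Vec d) :=
  Submodule.span ℝ (⋃ j ∈ {j | G.Adj i j}, S j)

/-- A run, on the problem `Q` and from the initial point `x₀`, of a decentralized first-order
algorithm over the network `G`. -/
structure Run {m d : ℕ} (G : SimpleGraph (Fin m)) (Q : StochProblem m d) (x₀ : Vec d) where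
  Ω : Type u
  mΩ : MeasurableSpace Ω
  P : Measure Ω
  prob : IsProbabilityMeasure P
  /-- The information available after `t` steps; `ℱ 0` may contain random bits of the
  algorithm itself. -/
  ℱ : Filtration ℕ mΩ
  /-- `batch t i` is the number of samples that node `i` draws in the step from time `t` to
  time `t + 1`; it is decided from the information available at time `t`. -/
  batch : ℕ → Fin m → Ω → ℕ
  batch_meas : ∀ t i, Measurable[ℱ t] (batch t i)
  /-- `ξ t i j` is the `j`-th random index that node `i` can draw in the step from time `t` to
  time `t + 1`. These indices are independent of one another and of the past. -/
  ξ : ℕ → Fin m → ℕ → Ω → Q.Ξ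
  ξ_meas : ∀ t i j, Measurable[ℱ (t + 1)] (ξ t i j)
  ξ_law : ∀ t i j, P.map (ξ t i j) = Q.law i
  ξ_iIndep : ∀ t, iIndepFun (fun k : Fin m × ℕ => ξ t k.1 k.2) P
  ξ_indep_past : ∀ t, Indep (⨆ k : Fin m × ℕ, Q.mΞ.comap (ξ t k.1 k.2)) (ℱ t) P
  /-- `delay i t` is the communication delay at node `i` and time `t`. It is at least one step, and
  what is received at time `t` is the memory of the neighbours at time `t - delay i t ≥ 0`. -/
  delay : Fin m → ℕ → ℕ
  delay_bounds : ∀ i t, 1 ≤ t → 1 ≤ delay i t ∧ delay i t ≤ t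
  /-- `mem t i` is the local memory of node `i` at time `t`. -/
  mem : ℕ → Fin m → Ω → Set (Vec d)
  mem_zero : ∀ i ω, mem 0 i ω = {x₀}
  mem_succ : ∀ t i ω, mem (t + 1) i ω ⊆
    compMemory Q i (mem t i ω) (batch t i ω) (fun j => ξ t i j ω) ∪
      commMemory G i (fun j => mem (t + 1 - delay i (t + 1)) j ω)
  /-- `out t i` is the current output of node `i` at time `t`. -/
  out : ℕ → Fin m → Ω → Vec d
  out_mem : ∀ t i ω, out t i ω ∈ mem t i ω
  out_meas : ∀ t i, Measurable[ℱ t] (out t i)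

attribute [instance] Run.mΩ Run.prob

namespace Run

variable {m d : ℕ} {G : SimpleGraph (Fin m)} {Q : StochProblem m d} {x₀ : Vec d}

/-- The expected total number of samples drawn by all nodes up to time `t`. A random index counts
once, however many points it is used at. -/
noncomputable def expectedSamples (R : Run.{u} G Q x₀) (t : ℕ) : ℝ≥0∞ :=
  ∫⁻ ω, ((∑ s ∈ Finset.range t, ∑ i, R.batch s i ω : ℕ) : ℝ≥0∞) ∂(R.P)

/-- The output of node `i` at time `t` is an `ε`-stationary point: `E ‖∇ f (out)‖² ≤ ε²`. The
lower integral is used so that an infinite expectation is not read as `0`. -/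
def IsStationary (R : Run.{u} G Q x₀) (ε : ℝ) (t : ℕ) (i : Fin m) : Prop :=
  ∫⁻ ω, ENNReal.ofReal (‖∇ Q.obj (R.out t i ω)‖ ^ 2) ∂(R.P) ≤ ENNReal.ofReal (ε ^ 2)

end Run

/-- A decentralized first-order algorithm over the network `G`: an initial point in every dimension,
which does not depend on the problem, and a run from it on every problem. -/
structure DecentralizedAlgorithm {m : ℕ} (G : SimpleGraph (Fin m)) where
  init : ∀ d : ℕ, Vec d
  run : ∀ {d : ℕ} (Q : StochProblem m d), Run.{u} G Q (init d)

/-- The arithmetic mean of the local standard deviations. -/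
noncomputable def sigmaAM {m : ℕ} (σ : Fin m → ℝ) : ℝ := (1 / (m : ℝ)) * ∑ i, σ i

/-! Each node gets its own chain of `T` orthonormal directions, all chains being mutually orthogonal
and orthogonal to `x₀`, and its local function sees only that chain. The gradient along a chain
vanishes beyond the first unexplored direction, and the oracle multiplies the component there by a
coin worth `1 / p i` with probability `p i` and `0` otherwise. So chain `i` advances by at most one
direction per step, and only when node `i` itself tosses a head; communication merely copies what is
known (`mem_subset_explored`). A union bound and Markov's inequality give T · P(chain i explored) ≤
p_i · E[samples of node i] (`mul_measure_le_nodeSamples`).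

An unfinished chain adds at least (s_i/r_i)²/4 to ‖∇f‖². Splitting the gap with weights w_i of sum 1
gives (s_i/r_i)² = w_i ΔL/(210T), and T ≈ ΔL/(3360ε²) makes this at least 16 w_i ε². A stationary
output therefore leaves a w-average of at most 1/4 of the chains unfinished, and if 1/p_i ≥ w_i K
for all i, then (3/4)TK samples are needed (`le_expectedSamples_of_isStationary`).

The variance budget allows p_i of order m² w_i ε²/σ_i², capped at 1. Weights proportional to σ_i
allow K of order σ̄²/ε², which yields the first term; uniform weights and p_i ≤ 1 allow K = m, which
yields the second. Whichever of σ̄² and mε² is larger decides. -/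

/-! ### The ramp. -/

/-- A `C^{1,1}` function that vanishes on `(-∞, 0]` and equals `1` on `[1, ∞)`. -/
noncomputable def ramp (x : ℝ) : ℝ :=
  2 * (max x 0 ^ 2 - 2 * max (x - 1 / 2) 0 ^ 2 + max (x - 1) 0 ^ 2)

/-- The derivative of `ramp`. -/
noncomputable def rampDeriv (x : ℝ) : ℝ :=
  4 * (max x 0 - 2 * max (x - 1 / 2) 0 + max (x - 1) 0)

theorem hasDerivAt_max_zero_sq (x : ℝ) :
    HasDerivAt (fun y : ℝ => max y 0 ^ 2) (2 * max x 0) x := by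
  rcases lt_trichotomy x 0 with h | rfl | h
  · have : (fun y : ℝ => max y 0 ^ 2) =ᶠ[nhds x] fun _ => 0 := by
      filter_upwards [gt_mem_nhds h] with y hy
      simp [max_eq_right hy.le]
    rw [max_eq_right h.le, mul_zero]
    exact (hasDerivAt_const x (0 : ℝ)).congr_of_eventuallyEq this
  · rw [hasDerivAt_iff_isLittleO_nhds_zero]
    refine Asymptotics.IsBigO.trans_isLittleO (g := fun h : ℝ => h ^ 2) ?_ ?_
    · refine Asymptotics.IsBigO.of_bound 1 (Filter.Eventually.of_forall fun h => ?_)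
      simp only [zero_add, max_self, mul_zero, smul_zero, sub_zero, Real.norm_eq_abs, one_mul]
      rcases le_total h 0 with h0 | h0
      · simp [max_eq_right h0]; positivity
      · simp [max_eq_left h0]
    · exact Asymptotics.isLittleO_pow_id one_lt_two
  · have : (fun y : ℝ => max y 0 ^ 2) =ᶠ[nhds x] fun y => y ^ 2 := by
      filter_upwards [lt_mem_nhds h] with y hy
      simp [max_eq_left hy.le]
    rw [max_eq_left h.le]
    simpa using (hasDerivAt_pow 2 x).congr_of_eventuallyEq this

theorem hasDerivAt_ramp (x : ℝ) : HasDerivAt ramp (rampDeriv x) x := by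
  have h1 := hasDerivAt_max_zero_sq x
  have h2 := (hasDerivAt_max_zero_sq (x - 1 / 2)).comp_sub_const x (1 / 2)
  have h3 := (hasDerivAt_max_zero_sq (x - 1)).comp_sub_const x 1
  refine (((h1.sub (h2.const_mul 2)).add h3).const_mul 2).congr_deriv ?_
  unfold rampDeriv
  ring

theorem ramp_zero : ramp 0 = 0 := by norm_num [ramp]

theorem rampDeriv_zero : rampDeriv 0 = 0 := by norm_num [rampDeriv]

theorem ramp_of_one_le {x : ℝ} (hx : 1 ≤ x) : ramp x = 1 := by
  unfold ramp
  rw [max_eq_left (by linarith), max_eq_left (by linarith), max_eq_left (by linarith)]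
  ring

theorem ramp_mem_Icc (x : ℝ) : 0 ≤ ramp x ∧ ramp x ≤ 1 := by
  unfold ramp
  rcases le_total x 0 with h1 | h1 <;> rcases le_total (x - 1 / 2) 0 with h2 | h2 <;>
    rcases le_total (x - 1) 0 with h3 | h3 <;> simp only [h1, h2, h3, max_eq_left, max_eq_right] <;>
    constructor <;> nlinarith

theorem rampDeriv_mem_Icc (x : ℝ) : 0 ≤ rampDeriv x ∧ rampDeriv x ≤ 2 := by
  unfold rampDeriv
  rcases le_total x 0 with h1 | h1 <;> rcases le_total (x - 1 / 2) 0 with h2 | h2 <;>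
    rcases le_total (x - 1) 0 with h3 | h3 <;> simp only [h1, h2, h3, max_eq_left, max_eq_right] <;>
    constructor <;> linarith

theorem abs_ramp_sub_le (x y : ℝ) : |ramp x - ramp y| ≤ 2 * |x - y| := by
  have := Convex.norm_image_sub_le_of_norm_hasDerivWithin_le (f := ramp) (f' := rampDeriv)
    (s := Set.univ) (x := y) (y := x) (C := 2) (fun z _ => (hasDerivAt_ramp z).hasDerivWithinAt)
    (fun z _ => by
      rw [Real.norm_eq_abs, abs_of_nonneg (rampDeriv_mem_Icc z).1]
      exact (rampDeriv_mem_Icc z).2) convex_univ trivial trivial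
  simpa using this

theorem abs_max_zero_sub_le (x y : ℝ) : |max x 0 - max y 0| ≤ |x - y| := by
  simpa using abs_max_sub_max_le_max x 0 y 0

/-- The constant is 4 · (1 + 2 + 1), the crude sum of the slopes of the three hinges. -/
theorem abs_rampDeriv_sub_le (x y : ℝ) : |rampDeriv x - rampDeriv y| ≤ 16 * |x - y| := by
  have h1 := abs_max_zero_sub_le x y
  have h2 := abs_max_zero_sub_le (x - 1 / 2) (y - 1 / 2)
  have h3 := abs_max_zero_sub_le (x - 1) (y - 1)
  rw [sub_sub_sub_cancel_right] at h2 h3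
  unfold rampDeriv
  rw [abs_le] at *
  constructor <;> linarith

/-! ### The hard chain: range of values, zero-chain property, smoothness. -/

/-- The `k`-th link of the hard chain, a function of two consecutive entries. -/
noncomputable def chainLink (x y : ℝ) : ℝ := -(ramp x * (1 + Real.sin y)) + max (-y) 0 ^ 2

/-- The hard chain of length `T`, as a function of the entries `a 1, …, a T`. -/
noncomputable def chainVal (T : ℕ) (a : ℕ → ℝ) : ℝ :=
  ∑ k ∈ Finset.range (T + 1), chainLink (a k) (a (k + 1))

/-- The partial derivative of the hard chain with respect to the entry `a (k + 1)`. -/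
noncomputable def chainGrad (a : ℕ → ℝ) (k : ℕ) : ℝ :=
  -(ramp (a k) * Real.cos (a (k + 1))) - rampDeriv (a (k + 1)) * (1 + Real.sin (a (k + 2)))
    - 2 * max (-a (k + 1)) 0

theorem chainLink_ge (x y : ℝ) : -2 ≤ chainLink x y := by
  unfold chainLink
  have h1 := ramp_mem_Icc x
  nlinarith [Real.sin_le_one y, Real.neg_one_le_sin y, sq_nonneg (max (-y) 0),
    mul_le_mul h1.2 (show 1 + Real.sin y ≤ 2 by linarith [Real.sin_le_one y])
      (by linarith [Real.neg_one_le_sin y]) zero_le_one]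

theorem chainLink_zero_ge (x : ℝ) : -1 ≤ chainLink x 0 := by
  have h1 := ramp_mem_Icc x
  simp only [chainLink, Real.sin_zero]
  norm_num
  exact h1.2

/-- The last link has second entry 0, so it costs at most 1 instead of 2. The bound is attained,
which later makes the optimality gap exact. -/
theorem chainVal_ge {T : ℕ} {a : ℕ → ℝ} (ha : a (T + 1) = 0) :
    -(2 * T + 1 : ℝ) ≤ chainVal T a := by
  unfold chainVal
  rw [Finset.sum_range_succ, ha]
  have := Finset.card_nsmul_le_sum (Finset.range T) (fun k => chainLink (a k) (a (k + 1))) (-2)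
    fun k _ => chainLink_ge _ _
  rw [Finset.card_range, nsmul_eq_mul] at this
  linarith [chainLink_zero_ge (a T)]

/-- The value π/2 maximises the sine and exceeds 1, where the ramp is saturated, so all links are
minimal at once. -/
theorem chainVal_eq_of_peak {T : ℕ} {a : ℕ → ℝ} (h0 : a 0 = 1)
    (ha : ∀ k < T, a (k + 1) = Real.pi / 2) (hend : a (T + 1) = 0) :
    chainVal T a = -(2 * T + 1 : ℝ) := by
  have hpi : (1 : ℝ) ≤ Real.pi / 2 := by linarith [Real.pi_gt_three]
  have hr : ∀ k ≤ T, ramp (a k) = 1 := by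
    rintro (_ | k) hk
    · exact ramp_of_one_le h0.ge
    · exact ramp_of_one_le (by rw [ha k hk]; exact hpi)
  unfold chainVal
  rw [Finset.sum_range_succ, hend, Finset.sum_congr rfl (g := fun _ => (-2 : ℝ))]
  · simp [chainLink, hr T le_rfl]
    ring
  · intro k hk
    rw [Finset.mem_range] at hk
    rw [chainLink, hr k hk.le, ha k hk, Real.sin_pi_div_two, max_eq_right (by linarith)]
    norm_num

theorem chainVal_eq_of_zero {T : ℕ} {a : ℕ → ℝ} (h0 : a 0 = 1) (ha : ∀ k, a (k + 1) = 0) :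
    chainVal T a = -1 := by
  unfold chainVal
  rw [Finset.sum_range_succ']
  simp [ha, h0, chainLink, ramp_zero, ramp_of_one_le]

/-- The zero-chain property: the ramp and its derivative both vanish at 0, so information travels
one link at a time. -/
theorem chainGrad_eq_zero {a : ℕ → ℝ} {k : ℕ} (h1 : a k = 0) (h2 : a (k + 1) = 0) :
    chainGrad a k = 0 := by
  simp [chainGrad, h1, h2, ramp_zero, rampDeriv_zero]

theorem sq_chainGrad_le_one {a : ℕ → ℝ} {k : ℕ} (h : a (k + 1) = 0) : chainGrad a k ^ 2 ≤ 1 := by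
  have := ramp_mem_Icc (a k)
  simp only [chainGrad, h, rampDeriv_zero, Real.cos_zero]
  norm_num
  rw [abs_of_nonneg this.1]
  exact this.2

/-- On [-1, 1] the cosine is at least 1/2 and the other terms have the favourable sign. Below -1 the
cosine may be negative, and the quadratic penalty takes over. -/
theorem chainGrad_le_of_lt_one {a : ℕ → ℝ} {k : ℕ} (h1 : 1 ≤ a k) (h2 : a (k + 1) < 1) :
    chainGrad a k ≤ -(1 / 2) := by
  unfold chainGrad
  rw [ramp_of_one_le h1]
  set y := a (k + 1)
  have hr := mul_nonneg (rampDeriv_mem_Icc y).1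
    (show 0 ≤ 1 + Real.sin (a (k + 2)) by linarith [Real.neg_one_le_sin (a (k + 2))])
  have hc := Real.one_sub_sq_div_two_le_cos (x := y)
  have hc' := Real.neg_one_le_cos y
  rcases le_total 0 y with h | h
  · have : 0 ≤ max (-y) 0 := le_max_right _ _
    nlinarith
  · rw [max_eq_left (by linarith)]
    rcases le_total (-1) y with h' | h' <;> nlinarith

/-- A chain whose last entry vanishes has a large partial derivative. -/
theorem exists_chainGrad_le {a : ℕ → ℝ} {T : ℕ} (h0 : a 0 = 1) (hT : a T = 0) :
    ∃ k < T, chainGrad a k ≤ -(1 / 2) := by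
  classical
  -- The first entry below 1 has a predecessor that is at least 1, because the chain starts at 1.
  have hex : ∃ n, a n < 1 := ⟨T, by rw [hT]; exact one_pos⟩
  have hle : Nat.find hex ≤ T := Nat.find_min' hex (by rw [hT]; exact one_pos)
  have hlt := Nat.find_spec hex
  obtain ⟨k, hk⟩ := Nat.exists_eq_succ_of_ne_zero (n := Nat.find hex) (by
    intro h
    rw [h, h0] at hlt
    exact lt_irrefl _ hlt)
  refine ⟨k, by omega, chainGrad_le_of_lt_one ?_ (by rw [hk] at hlt; exact hlt)⟩
  exact not_lt.1 (Nat.find_min hex (by omega))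

/-- The worst entry is the middle one: 35 = 1 + 32 + 2, from the cosine, the ramp derivative times a
factor at most 2, and the penalty. -/
theorem abs_chainGrad_sub_le (a b : ℕ → ℝ) (k : ℕ) :
    |chainGrad a k - chainGrad b k| ≤
      35 * (|a k - b k| + |a (k + 1) - b (k + 1)| + |a (k + 2) - b (k + 2)|) := by
  have prod : ∀ p q p' q' P Q : ℝ, |p| ≤ P → |q'| ≤ Q →
      |p * q - p' * q'| ≤ P * |q - q'| + Q * |p - p'| := by
    intro p q p' q' P Q hp hq
    have : p * q - p' * q' = p * (q - q') + q' * (p - p') := by ring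
    rw [this]
    refine (abs_add_le _ _).trans ?_
    rw [abs_mul, abs_mul]
    gcongr
  have h1 := prod (ramp (a k)) (Real.cos (a (k + 1))) (ramp (b k)) (Real.cos (b (k + 1))) 1 1
    (by rw [abs_of_nonneg (ramp_mem_Icc _).1]; exact (ramp_mem_Icc _).2) (Real.abs_cos_le_one _)
  have h2 := prod (rampDeriv (a (k + 1))) (1 + Real.sin (a (k + 2))) (rampDeriv (b (k + 1)))
    (1 + Real.sin (b (k + 2))) 2 2
    (by rw [abs_of_nonneg (rampDeriv_mem_Icc _).1]; exact (rampDeriv_mem_Icc _).2)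
    (by
      have := Real.sin_le_one (b (k + 2))
      have := Real.neg_one_le_sin (b (k + 2))
      rw [abs_le]
      constructor <;> linarith)
  have h3 := abs_ramp_sub_le (a k) (b k)
  have h4 := Real.abs_cos_sub_cos_le (a (k + 1)) (b (k + 1))
  have h5 := abs_rampDeriv_sub_le (a (k + 1)) (b (k + 1))
  have h6 := Real.abs_sin_sub_sin_le (a (k + 2)) (b (k + 2))
  have h7 := abs_max_zero_sub_le (-a (k + 1)) (-b (k + 1))
  rw [neg_sub_neg, abs_sub_comm (b (k + 1))] at h7
  rw [add_sub_add_left_eq_sub] at h2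
  have e : chainGrad a k - chainGrad b k =
      -(ramp (a k) * Real.cos (a (k + 1)) - ramp (b k) * Real.cos (b (k + 1)))
      - (rampDeriv (a (k + 1)) * (1 + Real.sin (a (k + 2)))
        - rampDeriv (b (k + 1)) * (1 + Real.sin (b (k + 2))))
      - 2 * (max (-a (k + 1)) 0 - max (-b (k + 1)) 0) := by
    unfold chainGrad
    ring
  have p1 := abs_nonneg (a k - b k)
  have p2 := abs_nonneg (a (k + 1) - b (k + 1))
  have p3 := abs_nonneg (a (k + 2) - b (k + 2))
  rw [e]
  have k1 := (abs_le.1 h1)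
  have k2 := (abs_le.1 h2)
  have k7 := (abs_le.1 h7)
  rw [abs_le]
  constructor <;> linarith [k1.1, k1.2, k2.1, k2.2, k7.1, k7.2]

/-- Here 105² = 35² · 3 · 3: one 3 from squaring a sum of three terms, the other from three shifted
sums, none larger than the middle one because the boundary entries agree. -/
theorem sum_sq_chainGrad_sub_le {T : ℕ} {a b : ℕ → ℝ} (h0 : a 0 = b 0)
    (hend : a (T + 1) = b (T + 1)) :
    ∑ k ∈ Finset.range T, (chainGrad a k - chainGrad b k) ^ 2 ≤
      105 ^ 2 * ∑ k ∈ Finset.range T, (a (k + 1) - b (k + 1)) ^ 2 := by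
  set δ : ℕ → ℝ := fun n => (a n - b n) ^ 2 with hδ
  have hδ0 : ∀ n, 0 ≤ δ n := fun n => sq_nonneg _
  have h1 : ∀ k ∈ Finset.range T, (chainGrad a k - chainGrad b k) ^ 2 ≤
      35 ^ 2 * 3 * (δ k + δ (k + 1) + δ (k + 2)) := by
    intro k _
    have h := abs_chainGrad_sub_le a b k
    rw [← sq_abs]
    refine (pow_le_pow_left₀ (abs_nonneg _) h 2).trans ?_
    simp only [hδ]
    rw [← sq_abs (a k - b k), ← sq_abs (a (k + 1) - b (k + 1)), ← sq_abs (a (k + 2) - b (k + 2))]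
    nlinarith [sq_nonneg (|a k - b k| - |a (k + 1) - b (k + 1)|),
      sq_nonneg (|a k - b k| - |a (k + 2) - b (k + 2)|),
      sq_nonneg (|a (k + 1) - b (k + 1)| - |a (k + 2) - b (k + 2)|)]
  have hA : ∑ k ∈ Finset.range T, δ k ≤ ∑ k ∈ Finset.range T, δ (k + 1) := by
    have e1 := Finset.sum_range_succ δ T
    rw [Finset.sum_range_succ'] at e1
    have : δ 0 = 0 := by simp [hδ, h0]
    linarith [hδ0 T]
  have hB : ∑ k ∈ Finset.range T, δ (k + 2) ≤ ∑ k ∈ Finset.range T, δ (k + 1) := by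
    have e1 := Finset.sum_range_succ (fun k => δ (k + 1)) T
    rw [Finset.sum_range_succ'] at e1
    have : δ (T + 1) = 0 := by simp [hδ, hend]
    simp only [zero_add] at e1
    linarith [hδ0 1]
  refine (Finset.sum_le_sum h1).trans ?_
  rw [← Finset.mul_sum, Finset.sum_add_distrib, Finset.sum_add_distrib]
  linarith

/-- Regrouping by entry instead of by link; the two end entries are fixed and leave no boundary
term. -/
theorem sum_chainLink_deriv_eq {T : ℕ} (a e : ℕ → ℝ) (h0 : e 0 = 0) (hend : e (T + 1) = 0) :
    ∑ k ∈ Finset.range (T + 1),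
      (-(rampDeriv (a k) * (1 + Real.sin (a (k + 1))) * e k
        + ramp (a k) * Real.cos (a (k + 1)) * e (k + 1)) - 2 * max (-a (k + 1)) 0 * e (k + 1)) =
      ∑ k ∈ Finset.range T, chainGrad a k * e (k + 1) := by
  have h1 : ∑ k ∈ Finset.range (T + 1), rampDeriv (a k) * (1 + Real.sin (a (k + 1))) * e k =
      ∑ k ∈ Finset.range T, rampDeriv (a (k + 1)) * (1 + Real.sin (a (k + 2))) * e (k + 1) := by
    rw [Finset.sum_range_succ', h0, mul_zero, add_zero]
  have h2 : ∑ k ∈ Finset.range (T + 1),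
      (-(ramp (a k) * Real.cos (a (k + 1))) - 2 * max (-a (k + 1)) 0) * e (k + 1) =
      ∑ k ∈ Finset.range T,
        (-(ramp (a k) * Real.cos (a (k + 1))) - 2 * max (-a (k + 1)) 0) * e (k + 1) := by
    rw [Finset.sum_range_succ, hend, mul_zero, add_zero]
  calc _ = ∑ k ∈ Finset.range (T + 1),
        (-(ramp (a k) * Real.cos (a (k + 1))) - 2 * max (-a (k + 1)) 0) * e (k + 1)
      - ∑ k ∈ Finset.range (T + 1), rampDeriv (a k) * (1 + Real.sin (a (k + 1))) * e k := by
        rw [← Finset.sum_sub_distrib]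
        exact Finset.sum_congr rfl fun k _ => by ring
    _ = _ := by
        rw [h1, h2, ← Finset.sum_sub_distrib]
        exact Finset.sum_congr rfl fun k _ => by
          unfold chainGrad
          ring

theorem hasFDerivAt_chainVal {E : Type*} [NormedAddCommGroup E] [NormedSpace ℝ E] {T : ℕ}
    {a : E → ℕ → ℝ} {e : ℕ → E →L[ℝ] ℝ} {x : E}
    (ha : ∀ n, HasFDerivAt (fun y => a y n) (e n) x) (h0 : e 0 = 0) (hend : e (T + 1) = 0) :
    HasFDerivAt (fun y => chainVal T (a y))
      (∑ k ∈ Finset.range T, chainGrad (a x) k • e (k + 1)) x := by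
  have h : HasFDerivAt (fun y => chainVal T (a y)) (∑ k ∈ Finset.range (T + 1),
      (-(ramp (a x k) • Real.cos (a x (k + 1)) • e (k + 1)
        + (1 + Real.sin (a x (k + 1))) • rampDeriv (a x k) • e k)
        + (2 * max (-a x (k + 1)) 0) • -e (k + 1))) x := by
    refine HasFDerivAt.fun_sum fun k _ => ?_
    refine HasFDerivAt.add (HasFDerivAt.neg (HasFDerivAt.mul ?_ ?_)) ?_
    · exact HasDerivAt.comp_hasFDerivAt (h₂ := ramp) x (hasDerivAt_ramp (a x k)) (ha k)
    · exact ((Real.hasDerivAt_sin _).comp_hasFDerivAt x (ha (k + 1))).const_add 1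
    · exact (hasDerivAt_max_zero_sq (-a x (k + 1))).comp_hasFDerivAt x (ha (k + 1)).neg
  refine h.congr_fderiv ?_
  ext w
  have := sum_chainLink_deriv_eq (T := T) (a x) (fun n => e n w) (by simp [h0]) (by simp [hend])
  simp only [sum_apply, add_apply, neg_apply, smul_apply, smul_eq_mul]
  rw [← this]
  exact Finset.sum_congr rfl fun k _ => by ring

/-! ### Orthonormal sums and biased coins. -/

theorem Orthonormal.sq_norm_sum_smul {E ι : Type*} [NormedAddCommGroup E] [InnerProductSpace ℝ E]
    [Fintype ι] {v : ι → E} (hv : Orthonormal ℝ v) (c : ι → ℝ) :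
    ‖∑ i, c i • v i‖ ^ 2 = ∑ i, c i ^ 2 := by
  rw [← real_inner_self_eq_norm_sq, hv.inner_sum]
  exact Finset.sum_congr rfl fun i _ => by simp [sq]

/-- The law on `Bool` that gives `true` the probability `p`. -/
noncomputable def coinLaw (p : ℝ) : Measure Bool :=
  ENNReal.ofReal p • Measure.dirac true + ENNReal.ofReal (1 - p) • Measure.dirac false

theorem isProbabilityMeasure_coinLaw {p : ℝ} (h0 : 0 ≤ p) (h1 : p ≤ 1) :
    IsProbabilityMeasure (coinLaw p) := by
  constructor
  simp only [coinLaw, Measure.add_apply, Measure.smul_apply, measure_univ, smul_eq_mul, mul_one]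
  rw [← ENNReal.ofReal_add h0 (by linarith)]
  simp

theorem coinLaw_singleton_true (p : ℝ) : coinLaw p {true} = ENNReal.ofReal p := by
  simp [coinLaw]

theorem integral_coinLaw {E : Type*} [NormedAddCommGroup E] [NormedSpace ℝ E] [CompleteSpace E]
    {p : ℝ} (h0 : 0 ≤ p) (h1 : p ≤ 1) (F : Bool → E) :
    ∫ z, F z ∂coinLaw p = p • F true + (1 - p) • F false := by
  have hi : ∀ (q : ℝ) (b : Bool), Integrable F (ENNReal.ofReal q • Measure.dirac b) := fun q b =>
    (integrable_dirac (by simp)).smul_measure ENNReal.ofReal_ne_top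
  rw [coinLaw, integral_add_measure (hi _ _) (hi _ _), integral_smul_measure,
    integral_smul_measure, integral_dirac, integral_dirac, ENNReal.toReal_ofReal h0,
    ENNReal.toReal_ofReal (by linarith)]

/-! ### The hard instance and its local gradients. -/

/-- The parameters of a hard instance made of `m` chains of length `T` along orthonormal
directions: the chain of node `i` has height `s i` and width `r i`, and the oracle of node `i`
reveals the next direction with probability `p i`. -/
structure ChainData (m T d : ℕ) where
  v : Fin m × Fin T → Vec d
  orthonormal : Orthonormal ℝ v
  s : Fin m → ℝ
  r : Fin m → ℝ
  p : Fin m → ℝ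
  s_pos : ∀ i, 0 < s i
  r_pos : ∀ i, 0 < r i
  p_pos : ∀ i, 0 < p i
  p_le_one : ∀ i, p i ≤ 1

namespace ChainData

variable {m T d : ℕ} (D : ChainData m T d)

/-- The rescaled coordinates of `x` along the chain of node `i`, preceded by `1` and followed by
zeros. -/
noncomputable def entry (i : Fin m) (x : Vec d) : ℕ → ℝ
  | 0 => 1
  | n + 1 => if h : n < T then inner ℝ (D.v (i, ⟨n, h⟩)) x / D.r i else 0

theorem entry_zero (i : Fin m) (x : Vec d) : D.entry i x 0 = 1 := rfl

theorem entry_succ (i : Fin m) (x : Vec d) (k : Fin T) :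
    D.entry i x (k + 1) = inner ℝ (D.v (i, k)) x / D.r i := by
  simp [entry]

theorem entry_end (i : Fin m) (x : Vec d) : D.entry i x (T + 1) = 0 := by
  simp [entry]

/-- The contribution of the `k`-th direction of node `i` to the gradient of the objective. -/
noncomputable def coeff (x : Vec d) (q : Fin m × Fin T) : ℝ :=
  D.s q.1 / D.r q.1 * chainGrad (D.entry q.1 x) q.2

/-- All coordinates of `x` along the chain of node `i` vanish from the `k`-th on. -/
def Unexplored (i : Fin m) (x : Vec d) (k : ℕ) : Prop :=
  ∀ k' : Fin T, k ≤ k' → inner ℝ (D.v (i, k')) x = 0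

open Classical in
/-- The random factor that the oracle of node `i` applies to the `k`-th coordinate. -/
noncomputable def factor (i : Fin m) (x : Vec d) (k : Fin T) (z : Bool) : ℝ :=
  if D.Unexplored i x k then (if z then (D.p i)⁻¹ else 0) else 1

/-- The local function of node `i`. -/
noncomputable def localFun (i : Fin m) (x : Vec d) : ℝ :=
  m * D.s i * chainVal T (D.entry i x)

/-- The gradient of the local function of node `i`. -/
noncomputable def localGrad (i : Fin m) (x : Vec d) : Vec d :=
  ∑ k, (m * D.coeff x (i, k)) • D.v (i, k)

/-- The stochastic gradient of node `i`. -/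
noncomputable def oracle (i : Fin m) (x : Vec d) (z : Bool) : Vec d :=
  ∑ k, (m * D.coeff x (i, k) * D.factor i x k z) • D.v (i, k)

theorem orthonormal_block (i : Fin m) : Orthonormal ℝ fun k : Fin T => D.v (i, k) :=
  D.orthonormal.comp (fun k => (i, k)) fun _ _ h => (Prod.mk.inj h).2

theorem hasGradientAt_localFun (i : Fin m) (x : Vec d) :
    HasGradientAt (D.localFun i) (D.localGrad i x) x := by
  rw [hasGradientAt_iff_hasFDerivAt]
  let e : ℕ → Vec d →L[ℝ] ℝ := fun n => match n with
    | 0 => 0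
    | n + 1 => if h : n < T then (D.r i)⁻¹ • innerSL ℝ (D.v (i, ⟨n, h⟩)) else 0
  have ha : ∀ n, HasFDerivAt (fun y => D.entry i y n) (e n) x := by
    rintro (_ | n)
    · exact hasFDerivAt_const (1 : ℝ) x
    · by_cases h : n < T
      · have h1 : (fun y => D.entry i y (n + 1)) =
            fun y => (D.r i)⁻¹ • innerSL ℝ (D.v (i, ⟨n, h⟩)) y := by
          ext y
          simp [entry, h, div_eq_inv_mul]
        have h2 : e (n + 1) = (D.r i)⁻¹ • innerSL ℝ (D.v (i, ⟨n, h⟩)) := by simp [e, h]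
        rw [h1, h2]
        exact ((D.r i)⁻¹ • innerSL ℝ (D.v (i, ⟨n, h⟩))).hasFDerivAt
      · have h1 : (fun y => D.entry i y (n + 1)) = fun _ => 0 := by
          ext y
          simp [entry, h]
        have h2 : e (n + 1) = 0 := by simp [e, h]
        rw [h1, h2]
        exact hasFDerivAt_const (0 : ℝ) x
  have key := (hasFDerivAt_chainVal (T := T) ha rfl (by simp [e])).const_smul (m * D.s i)
  refine key.congr_fderiv ?_
  ext w
  simp only [smul_apply, sum_apply, smul_eq_mul, InnerProductSpace.toDual_apply_apply, localGrad,
    sum_inner, Finset.sum_range, Finset.mul_sum]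
  refine Finset.sum_congr rfl fun k _ => ?_
  have : e (k + 1) w = inner ℝ (D.v (i, k)) w / D.r i := by
    simp [e, div_eq_inv_mul]
  rw [this, real_inner_smul_left, coeff]
  ring

theorem continuous_entry (i : Fin m) (n : ℕ) : Continuous fun x => D.entry i x n := by
  rcases n with _ | n
  · exact continuous_const
  · by_cases h : n < T
    · simp only [entry, h, dif_pos]
      fun_prop
    · simp only [entry, h, dif_neg, not_false_eq_true]
      exact continuous_const

theorem continuous_coeff (q : Fin m × Fin T) : Continuous fun x => D.coeff x q := by
  have := D.continuous_entry q.1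
  unfold coeff chainGrad ramp rampDeriv
  fun_prop

theorem measurableSet_unexplored (i : Fin m) (k : ℕ) : MeasurableSet {x | D.Unexplored i x k} := by
  have : {x | D.Unexplored i x k} =
      ⋂ k' : Fin T, ⋂ _ : k ≤ k', {x | inner ℝ (D.v (i, k')) x = 0} := by
    ext x
    simp [Unexplored]
  rw [this]
  refine MeasurableSet.iInter fun k' => MeasurableSet.iInter fun _ => ?_
  exact (isClosed_eq (by fun_prop) continuous_const).measurableSet

theorem measurable_oracle (i : Fin m) : Measurable (Function.uncurry (D.oracle i)) := by
  refine measurable_from_prod_countable_left fun z => ?_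
  simp only [Function.uncurry, oracle]
  refine Finset.measurable_sum _ fun k _ => Measurable.smul_const ?_ _
  refine ((D.continuous_coeff (i, k)).measurable.const_mul _).mul ?_
  unfold factor
  exact Measurable.ite (D.measurableSet_unexplored i k) measurable_const measurable_const

/-- The hard instance. -/
noncomputable def problem : StochProblem m d where
  Ξ := Bool
  mΞ := inferInstance
  law i := coinLaw (D.p i)
  law_prob i := isProbabilityMeasure_coinLaw (D.p_pos i).le (D.p_le_one i)
  f := D.localFun
  g := D.oracle
  g_meas := D.measurable_oracle

/-! ### Unexplored coordinates and the oracle noise. -/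

theorem coeff_eq_zero_of_unexplored {i : Fin m} {x : Vec d} {k : ℕ} (h : D.Unexplored i x k)
    {k' : Fin T} (hk : k < k') : D.coeff x (i, k') = 0 := by
  have h2 : D.entry i x (k' + 1) = 0 := by rw [entry_succ, h k' hk.le, zero_div]
  have h1 : D.entry i x k' = 0 := by
    -- Entry `k'` is coordinate `k' - 1`, which is still unexplored because `k < k'` is strict.
    have := D.entry_succ i x ⟨k' - 1, by omega⟩
    rw [h _ (by simp only; omega), zero_div] at this
    simpa [Nat.sub_add_cancel (show 1 ≤ (k' : ℕ) by omega)] using this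
  simp [coeff, chainGrad_eq_zero h1 h2]

theorem sq_coeff_le_of_unexplored {i : Fin m} {x : Vec d} {k : Fin T} (h : D.Unexplored i x k) :
    D.coeff x (i, k) ^ 2 ≤ (D.s i / D.r i) ^ 2 := by
  have h2 : D.entry i x (k + 1) = 0 := by rw [entry_succ, h k le_rfl, zero_div]
  rw [coeff, mul_pow]
  exact mul_le_of_le_one_right (sq_nonneg _) (sq_chainGrad_le_one h2)

-- Every unexplored coordinate is randomised, but at most one of them has a nonzero coefficient, so
-- the noise does not grow with `T`.
open Classical in
theorem sum_sq_coeff_unexplored_le (i : Fin m) (x : Vec d) :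
    ∑ k : Fin T, (if D.Unexplored i x k then D.coeff x (i, k) ^ 2 else 0) ≤
      (D.s i / D.r i) ^ 2 := by
  by_cases hex : ∃ k : Fin T, D.Unexplored i x k ∧ D.coeff x (i, k) ≠ 0
  · obtain ⟨k, hk, hk0⟩ := hex
    rw [Finset.sum_eq_single k]
    · rw [if_pos hk]
      exact D.sq_coeff_le_of_unexplored hk
    · intro k' _ hne
      split_ifs with h
      · rcases lt_or_gt_of_ne hne with hlt | hlt
        · exact absurd (D.coeff_eq_zero_of_unexplored h (k' := k) hlt) hk0
        · rw [D.coeff_eq_zero_of_unexplored hk hlt, zero_pow two_ne_zero]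
      · rfl
    · simp
  · push Not at hex
    rw [Finset.sum_eq_zero]
    · positivity
    · intro k _
      split_ifs with h
      · rw [hex k h, zero_pow two_ne_zero]
      · rfl

theorem integral_factor (i : Fin m) (x : Vec d) (k : Fin T) :
    D.p i * D.factor i x k true + (1 - D.p i) * D.factor i x k false = 1 := by
  have := (D.p_pos i).ne'
  unfold factor
  by_cases h : D.Unexplored i x k <;> simp [h, this]

open Classical in
theorem integral_sq_factor_sub_one (i : Fin m) (x : Vec d) (k : Fin T) :
    D.p i * (D.factor i x k true - 1) ^ 2 + (1 - D.p i) * (D.factor i x k false - 1) ^ 2 =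
      if D.Unexplored i x k then (D.p i)⁻¹ - 1 else 0 := by
  have := (D.p_pos i).ne'
  unfold factor
  by_cases h : D.Unexplored i x k
  · simp only [h, if_true, Bool.false_eq_true, if_false]
    field_simp
    ring
  · simp [h]

theorem integral_oracle (i : Fin m) (x : Vec d) :
    ∫ z, D.oracle i x z ∂coinLaw (D.p i) = D.localGrad i x := by
  rw [integral_coinLaw (D.p_pos i).le (D.p_le_one i)]
  simp only [oracle, localGrad, Finset.smul_sum, smul_smul]
  rw [← Finset.sum_add_distrib]
  refine Finset.sum_congr rfl fun k _ => ?_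
  rw [← add_smul]
  congr 1
  linear_combination (m * D.coeff x (i, k)) * D.integral_factor i x k

/-- By orthonormality the variance splits over coordinates, and the coin of mean 1 has variance 1/p
- 1. -/
theorem integral_sq_oracle_sub_le (i : Fin m) (x : Vec d) :
    ∫ z, ‖D.oracle i x z - D.localGrad i x‖ ^ 2 ∂coinLaw (D.p i) ≤
      (m * (D.s i / D.r i)) ^ 2 * ((D.p i)⁻¹ - 1) := by
  classical
  have h : ∀ z, ‖D.oracle i x z - D.localGrad i x‖ ^ 2 =
      ∑ k, (m * D.coeff x (i, k)) ^ 2 * (D.factor i x k z - 1) ^ 2 := by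
    intro z
    rw [oracle, localGrad, ← Finset.sum_sub_distrib]
    simp_rw [← sub_smul]
    rw [(D.orthonormal_block i).sq_norm_sum_smul]
    exact Finset.sum_congr rfl fun k _ => by ring
  have hp : 0 ≤ (D.p i)⁻¹ - 1 := sub_nonneg.2 ((one_le_inv₀ (D.p_pos i)).2 (D.p_le_one i))
  rw [integral_coinLaw (D.p_pos i).le (D.p_le_one i), h, h]
  calc _ = ((m : ℝ) ^ 2 * ((D.p i)⁻¹ - 1)) *
        ∑ k : Fin T, (if D.Unexplored i x k then D.coeff x (i, k) ^ 2 else 0) := by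
        rw [smul_eq_mul, smul_eq_mul, Finset.mul_sum, Finset.mul_sum, Finset.mul_sum,
          ← Finset.sum_add_distrib]
        refine Finset.sum_congr rfl fun k _ => ?_
        have := D.integral_sq_factor_sub_one i x k
        split_ifs at this ⊢ <;> linear_combination (m * D.coeff x (i, k)) ^ 2 * this
    _ ≤ ((m : ℝ) ^ 2 * ((D.p i)⁻¹ - 1)) * (D.s i / D.r i) ^ 2 := by
        gcongr
        exact D.sum_sq_coeff_unexplored_le i x
    _ = _ := by ring

/-! ### The global objective: smoothness, optimality gap, large gradients. -/

theorem hasGradientAt_obj (hm : 0 < m) (x : Vec d) :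
    HasGradientAt D.problem.obj (∑ q, D.coeff x q • D.v q) x := by
  have h1 : HasFDerivAt (fun y => (1 / (m : ℝ)) * ∑ i, D.localFun i y)
      ((1 / (m : ℝ)) • ∑ i, InnerProductSpace.toDual ℝ (Vec d) (D.localGrad i x)) x :=
    (HasFDerivAt.fun_sum fun i _ => (D.hasGradientAt_localFun i x).hasFDerivAt).const_mul _
  rw [hasGradientAt_iff_hasFDerivAt]
  refine h1.congr_fderiv ?_
  rw [← map_sum, ← map_smul]
  congr 1
  rw [Fintype.sum_prod_type, Finset.smul_sum]
  refine Finset.sum_congr rfl fun i _ => ?_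
  rw [localGrad, Finset.smul_sum]
  refine Finset.sum_congr rfl fun k _ => ?_
  rw [smul_smul]
  congr 1
  field_simp

/-- Height s and width r rescale the Lipschitz constant 105 of the unit chain's gradient to 105 s /
r², which is L. -/
theorem sum_sq_coeff_sub_le {L : ℝ} (hL : ∀ i, 105 * D.s i = L * D.r i ^ 2) (i : Fin m)
    (x y : Vec d) :
    ∑ k, (D.coeff x (i, k) - D.coeff y (i, k)) ^ 2 ≤
      L ^ 2 * ∑ k, inner ℝ (D.v (i, k)) (x - y) ^ 2 := by
  have h := sum_sq_chainGrad_sub_le (T := T) (a := D.entry i x) (b := D.entry i y) rfl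
    (by rw [entry_end, entry_end])
  rw [Finset.sum_range, Finset.sum_range] at h
  have hr := (D.r_pos i).ne'
  calc _ = (D.s i / D.r i) ^ 2 *
        ∑ k : Fin T, (chainGrad (D.entry i x) k - chainGrad (D.entry i y) k) ^ 2 := by
        rw [Finset.mul_sum]
        exact Finset.sum_congr rfl fun k _ => by
          simp only [coeff]
          ring
    _ ≤ (D.s i / D.r i) ^ 2 *
        (105 ^ 2 * ∑ k : Fin T, (D.entry i x (k + 1) - D.entry i y (k + 1)) ^ 2) := by gcongr
    _ = _ := by
        have hL' : L = 105 * D.s i / D.r i ^ 2 := by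
          rw [hL]
          field_simp
        simp only [entry_succ, Finset.mul_sum, inner_sub_right, hL']
        refine Finset.sum_congr rfl fun k _ => ?_
        field_simp

/-- Orthogonal chains contribute in squares and Bessel's inequality collects them, so no factor `m`
is lost. -/
theorem smooth_obj {L : ℝ} (hL : ∀ i, 105 * D.s i = L * D.r i ^ 2) (x y : Vec d) :
    ‖∑ q, D.coeff x q • D.v q - ∑ q, D.coeff y q • D.v q‖ ^ 2 ≤ L ^ 2 * ‖x - y‖ ^ 2 := by
  rw [← Finset.sum_sub_distrib]
  simp_rw [← sub_smul]
  rw [D.orthonormal.sq_norm_sum_smul, Fintype.sum_prod_type]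
  refine (Finset.sum_le_sum fun i _ => D.sum_sq_coeff_sub_le hL i x y).trans ?_
  rw [← Finset.mul_sum, ← Fintype.sum_prod_type' (f := fun i k => inner ℝ (D.v (i, k)) (x - y) ^ 2)]
  gcongr
  simpa using D.orthonormal.sum_inner_products_le (x - y) (s := Finset.univ)

theorem smooth_localGrad {L : ℝ} (hL : ∀ i, 105 * D.s i = L * D.r i ^ 2) (i : Fin m)
    (x y : Vec d) :
    ‖D.localGrad i x - D.localGrad i y‖ ^ 2 ≤ (m : ℝ) ^ 2 * L ^ 2 * ‖x - y‖ ^ 2 := by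
  rw [localGrad, localGrad, ← Finset.sum_sub_distrib]
  simp_rw [← sub_smul]
  rw [(D.orthonormal_block i).sq_norm_sum_smul]
  simp_rw [← mul_sub, mul_pow]
  rw [← Finset.mul_sum, mul_assoc]
  refine mul_le_mul_of_nonneg_left ?_ (sq_nonneg _)
  refine (D.sum_sq_coeff_sub_le hL i x y).trans ?_
  gcongr
  simpa using (D.orthonormal_block i).sum_inner_products_le (x - y) (s := Finset.univ)

theorem obj_eq (hm : 0 < m) (x : Vec d) :
    D.problem.obj x = ∑ i, D.s i * chainVal T (D.entry i x) := by
  simp only [StochProblem.obj, problem, localFun, Finset.mul_sum]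
  refine Finset.sum_congr rfl fun i _ => ?_
  field_simp

/-- Orthonormality allows one point to put every chain at its peak simultaneously. -/
theorem isLeast_obj (hm : 0 < m) :
    IsLeast (Set.range D.problem.obj) (∑ i, D.s i * -(2 * T + 1 : ℝ)) := by
  constructor
  · refine ⟨∑ q, (D.r q.1 * (Real.pi / 2)) • D.v q, ?_⟩
    rw [D.obj_eq hm]
    refine Finset.sum_congr rfl fun i _ => ?_
    rw [chainVal_eq_of_peak (D.entry_zero i _) _ (D.entry_end i _)]
    intro k hk
    have := D.entry_succ i (∑ q, (D.r q.1 * (Real.pi / 2)) • D.v q) ⟨k, hk⟩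
    rw [D.orthonormal.inner_right_fintype] at this
    rw [this]
    have := (D.r_pos i).ne'
    field_simp
  · rintro _ ⟨x, rfl⟩
    rw [D.obj_eq hm]
    exact Finset.sum_le_sum fun i _ =>
      mul_le_mul_of_nonneg_left (chainVal_ge (D.entry_end i x)) (D.s_pos i).le

theorem obj_of_forall_inner_eq_zero (hm : 0 < m) {x : Vec d}
    (hx : ∀ q, inner ℝ (D.v q) x = 0) : D.problem.obj x = ∑ i, D.s i * -1 := by
  rw [D.obj_eq hm]
  refine Finset.sum_congr rfl fun i _ => ?_
  rw [chainVal_eq_of_zero (D.entry_zero i x)]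
  intro k
  simp [entry, hx]

theorem satisfies (hm : 0 < m) {x₀ : Vec d} (hx : ∀ q, inner ℝ (D.v q) x₀ = 0) {Δ L : ℝ}
    {σ : Fin m → ℝ} (hΔ : ∑ i, D.s i * (2 * T) = Δ) (hL : ∀ i, 105 * D.s i = L * D.r i ^ 2)
    (hσ : ∀ i, (m * (D.s i / D.r i)) ^ 2 * ((D.p i)⁻¹ - 1) ≤ σ i ^ 2) :
    D.problem.Satisfies x₀ Δ L σ where
  bddBelow := ⟨_, (D.isLeast_obj hm).2⟩
  gap := by
    rw [iInf, (D.isLeast_obj hm).csInf_eq, D.obj_of_forall_inner_eq_zero hm hx, ← hΔ,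
      ← Finset.sum_sub_distrib]
    exact Finset.sum_congr rfl fun i _ => by ring
  differentiable i x := (D.hasGradientAt_localFun i x).hasFDerivAt.differentiableAt
  memLp i x := by
    have := isProbabilityMeasure_coinLaw (D.p_pos i).le (D.p_le_one i)
    exact MemLp.of_discrete (α := Bool) (μ := coinLaw (D.p i))
  unbiased i x := by
    rw [show D.problem.f i = D.localFun i from rfl, (D.hasGradientAt_localFun i x).gradient]
    exact D.integral_oracle i x
  variance i x := by
    rw [show D.problem.f i = D.localFun i from rfl, (D.hasGradientAt_localFun i x).gradient]
    exact (D.integral_sq_oracle_sub_le i x).trans (hσ i)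
  smooth x y := by
    rw [(D.hasGradientAt_obj hm x).gradient, (D.hasGradientAt_obj hm y).gradient]
    exact D.smooth_obj hL x y
  smooth_local i x y := by
    rw [show D.problem.f i = D.localFun i from rfl, (D.hasGradientAt_localFun i x).gradient,
      (D.hasGradientAt_localFun i y).gradient]
    exact D.smooth_localGrad hL i x y

/-- The gradient of the objective is large while some chains are not fully explored. -/
theorem sum_le_sq_norm_gradient_obj (hm : 0 < m) (hT : 0 < T) (x : Vec d) (S : Finset (Fin m))
    (hS : ∀ i ∈ S, D.Unexplored i x (T - 1)) :
    ∑ i ∈ S, (D.s i / D.r i) ^ 2 / 4 ≤ ‖∇ D.problem.obj x‖ ^ 2 := by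
  rw [(D.hasGradientAt_obj hm x).gradient, D.orthonormal.sq_norm_sum_smul, Fintype.sum_prod_type]
  refine (Finset.sum_le_sum fun i hi => ?_).trans
    (Finset.sum_le_sum_of_subset_of_nonneg (Finset.subset_univ S)
      fun i _ _ => Finset.sum_nonneg fun k _ => sq_nonneg _)
  -- Coordinate `T - 1` is entry `T`: one missing last direction already blocks the chain.
  have hlast : D.entry i x T = 0 := by
    have := D.entry_succ i x ⟨T - 1, by omega⟩
    rw [hS i hi _ le_rfl, zero_div] at this
    simpa [Nat.sub_add_cancel hT] using this
  obtain ⟨k, hk, hgrad⟩ := exists_chainGrad_le (D.entry_zero i x) hlast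
  refine le_trans ?_ (Finset.single_le_sum (fun k _ => sq_nonneg (D.coeff x (i, k)))
    (Finset.mem_univ ⟨k, hk⟩))
  simp only [coeff, mul_pow]
  rw [div_eq_mul_inv]
  refine mul_le_mul_of_nonneg_left ?_ (sq_nonneg _)
  nlinarith


/-! ### Progress of the memories. -/

/-- The vectors along which at most the first `c i` directions of each node `i` are explored. -/
noncomputable def explored (c : Fin m → ℕ) : Submodule ℝ (Vec d) where
  carrier := {x | ∀ i, D.Unexplored i x (c i)}
  add_mem' hx hy i k hk := by rw [inner_add_right, hx i k hk, hy i k hk, add_zero]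
  zero_mem' i k _ := inner_zero_right _
  smul_mem' a x hx i k hk := by rw [real_inner_smul_right, hx i k hk, mul_zero]

theorem explored_mono {c c' : Fin m → ℕ} (h : c ≤ c') : D.explored c ≤ D.explored c' :=
  fun _ hx i k hk => hx i k ((h i).trans hk)

/-- Beyond coordinate `c n` the coefficients vanish, and at `c n` itself a tail erases the answer.
The other chains are orthogonal to it. -/
theorem oracle_mem_explored {c c' : Fin m → ℕ} (h : c ≤ c') {n : Fin m} {x : Vec d}
    (hx : x ∈ D.explored c) {z : Bool} (hz : z = true → c n + 1 ≤ c' n) :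
    D.oracle n x z ∈ D.explored c' := by
  intro i k hk
  by_cases hi : i = n
  · subst hi
    rw [oracle, (D.orthonormal_block i).inner_right_fintype]
    have hxi := hx i
    rcases lt_or_ge (c i) k with hlt | hge
    · rw [D.coeff_eq_zero_of_unexplored hxi hlt, mul_zero, zero_mul]
    · have hck : c i = k := le_antisymm ((h i).trans hk) hge
      have hzf : z = false := by
        rw [← Bool.not_eq_true]
        intro hzt
        have := hz hzt
        omega
      rw [hck] at hxi
      simp [factor, hxi, hzf]
  · rw [oracle, inner_sum]
    refine Finset.sum_eq_zero fun k' _ => ?_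
    rw [real_inner_smul_right, D.orthonormal.inner_eq_zero (fun h => hi (Prod.mk.inj h).1), mul_zero]

variable {D} {G : SimpleGraph (Fin m)} {x₀ : Vec d} (R : Run.{u} G D.problem x₀)

variable (D) in
/-- The samples that reveal the next direction. -/
def heads : Set D.problem.Ξ := ({true} : Set Bool)

variable (D) in
theorem measurableSet_heads : MeasurableSet D.heads := MeasurableSet.of_discrete (α := Bool)

variable (D) in
theorem law_heads (i : Fin m) : D.problem.law i D.heads = ENNReal.ofReal (D.p i) :=
  coinLaw_singleton_true (D.p i)

/-- The event that node `i` draws a successful sample in the step from time `t` to `t + 1`. -/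
def success (t : ℕ) (i : Fin m) : Set R.Ω :=
  ⋃ j : ℕ, {ω | j < R.batch t i ω} ∩ R.ξ t i j ⁻¹' D.heads

open Classical in
/-- The number of steps before time `t` in which node `i` draws a successful sample. -/
noncomputable def successCount (t : ℕ) (ω : R.Ω) (i : Fin m) : ℕ :=
  ∑ s ∈ Finset.range t, if ω ∈ success R s i then 1 else 0

theorem successCount_mono (ω : R.Ω) : Monotone fun t => successCount R t ω := by
  intro s t h i
  exact Finset.sum_le_sum_of_subset (Finset.range_mono h)

/-- The explored vectors form a subspace that grows with the counts, so spans and delayed memories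
of neighbours stay inside. All queries of a step are made at points of the previous memory, so
several heads in one batch still advance the chain by one. -/
theorem mem_subset_explored (hx : ∀ q, inner ℝ (D.v q) x₀ = 0) (ω : R.Ω) (t : ℕ) (n : Fin m) :
    R.mem t n ω ⊆ D.explored (successCount R t ω) := by
  induction t using Nat.strong_induction_on generalizing n with
  | _ t ih =>
    rcases t with _ | t
    · rw [R.mem_zero, Set.singleton_subset_iff]
      exact fun i k _ => hx (i, k)
    · have hmono := successCount_mono R ω
      refine (R.mem_succ t n ω).trans (Set.union_subset ?_ ?_)
      · refine Submodule.span_le.2 (Set.union_subset ?_ ?_)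
        · exact (ih t (Nat.lt_succ_self t) n).trans (D.explored_mono (hmono t.le_succ))
        · rintro _ ⟨x, hx, j, hj, rfl⟩
          refine D.oracle_mem_explored (hmono t.le_succ) (ih t (Nat.lt_succ_self t) n hx) ?_
          intro hz
          have : ω ∈ success R t n := Set.mem_iUnion.2 ⟨j, hj, hz⟩
          simp only [successCount]
          rw [Finset.sum_range_succ, if_pos this]
      · have hd := R.delay_bounds n (t + 1) (by omega)
        refine Submodule.span_le.2 (Set.iUnion₂_subset fun j _ => ?_)
        exact (ih _ (by omega) j).trans (D.explored_mono (hmono (by omega)))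

/-! ### From successes to samples. -/

theorem measurableSet_success (t : ℕ) (i : Fin m) : MeasurableSet (success R t i) := by
  refine MeasurableSet.iUnion fun j => MeasurableSet.inter ?_ ?_
  · exact ((R.batch_meas t i).mono (R.ℱ.le t) le_rfl) (measurableSet_Ioi (a := j))
  · exact ((R.ξ_meas t i j).mono (R.ℱ.le (t + 1)) le_rfl) D.measurableSet_heads

theorem measurable_batch (t : ℕ) (i : Fin m) : Measurable (R.batch t i) :=
  (R.batch_meas t i).mono (R.ℱ.le t) le_rfl

theorem tsum_indicator_lt (n : ℕ) : ∑' j : ℕ, (if j < n then 1 else 0 : ℝ≥0∞) = n := by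
  rw [tsum_eq_sum (s := Finset.range n) (by
    intro j hj
    rw [if_neg (by simpa using hj)])]
  rw [Finset.sum_congr rfl (g := fun _ => 1) (fun j hj => if_pos (Finset.mem_range.1 hj))]
  simp

/-- The batch size is known before the step, so drawing a `j`-th sample is independent of its coin.
A union bound over `j` then sums P(j < B) to E[B]. -/
theorem measure_success_le (t : ℕ) (i : Fin m) :
    R.P (success R t i) ≤ ENNReal.ofReal (D.p i) * ∫⁻ ω, (R.batch t i ω : ℝ≥0∞) ∂(R.P) := by
  have hmeas : ∀ j, MeasurableSet {ω | j < R.batch t i ω} := fun j =>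
    measurable_batch R t i (measurableSet_Ioi (a := j))
  have hj : ∀ j, R.P ({ω | j < R.batch t i ω} ∩ R.ξ t i j ⁻¹' D.heads) =
      ENNReal.ofReal (D.p i) * R.P {ω | j < R.batch t i ω} := by
    intro j
    have hind := (ProbabilityTheory.Indep_iff _ _ _).1 (R.ξ_indep_past t)
      (R.ξ t i j ⁻¹' D.heads) {ω | j < R.batch t i ω}
      (le_iSup (fun k : Fin m × ℕ => D.problem.mΞ.comap (R.ξ t k.1 k.2)) (i, j) _
        ⟨_, D.measurableSet_heads, rfl⟩)
      (R.batch_meas t i (measurableSet_Ioi (a := j)))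
    rw [Set.inter_comm, hind]
    congr 1
    rw [← Measure.map_apply ((R.ξ_meas t i j).mono (R.ℱ.le (t + 1)) le_rfl)
      D.measurableSet_heads, R.ξ_law]
    exact D.law_heads i
  calc R.P (success R t i) ≤ ∑' j, ENNReal.ofReal (D.p i) * R.P {ω | j < R.batch t i ω} :=
        (measure_iUnion_le _).trans_eq (tsum_congr hj)
    _ = ENNReal.ofReal (D.p i) * ∫⁻ ω, ∑' j, (if j < R.batch t i ω then 1 else 0) ∂(R.P) := by
        rw [ENNReal.tsum_mul_left, lintegral_tsum]
        · congr 1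
          refine tsum_congr fun j => ?_
          rw [← lintegral_indicator_one (hmeas j)]
          exact lintegral_congr fun a => by by_cases h : j < R.batch t i a <;> simp [h]
        · exact fun j => (Measurable.ite (hmeas j) measurable_const measurable_const).aemeasurable
    _ = _ := by simp_rw [tsum_indicator_lt]

theorem measurable_successCount (t : ℕ) (i : Fin m) :
    Measurable fun ω => successCount R t ω i :=
  Finset.measurable_sum _ fun s _ =>
    Measurable.ite (measurableSet_success R s i) measurable_const measurable_const

/-- The expected number of samples that node `i` draws before time `t`. -/
noncomputable def nodeSamples (t : ℕ) (i : Fin m) : ℝ≥0∞ :=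
  ∑ s ∈ Finset.range t, ∫⁻ ω, (R.batch s i ω : ℝ≥0∞) ∂(R.P)

theorem expectedSamples_eq (t : ℕ) : R.expectedSamples t = ∑ i, nodeSamples R t i := by
  simp only [Run.expectedSamples, nodeSamples, Nat.cast_sum]
  rw [Finset.sum_comm, lintegral_finsetSum]
  · refine Finset.sum_congr rfl fun s _ => ?_
    rw [lintegral_finsetSum]
    exact fun i _ => measurable_from_top.comp (measurable_batch R s i)
  · exact fun s _ => Finset.measurable_sum _ fun i _ =>
      measurable_from_top.comp (measurable_batch R s i)

/-- Markov's inequality for the number of successes, whose mean is bounded step by step. -/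
theorem mul_measure_le_nodeSamples (t : ℕ) (i : Fin m) :
    T * R.P {ω | T ≤ successCount R t ω i} ≤ ENNReal.ofReal (D.p i) * nodeSamples R t i := by
  have h1 : ∫⁻ ω, (successCount R t ω i : ℝ≥0∞) ∂(R.P) =
      ∑ s ∈ Finset.range t, R.P (success R s i) := by
    simp only [successCount, Nat.cast_sum]
    rw [lintegral_finsetSum]
    · refine Finset.sum_congr rfl fun s _ => ?_
      rw [← lintegral_indicator_one (measurableSet_success R s i)]
      congr 1
      ext ω
      by_cases h : ω ∈ success R s i <;> simp [h]
    · exact fun s _ => measurable_from_top.comp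
        (Measurable.ite (measurableSet_success R s i) measurable_const measurable_const)
  have h2 := mul_meas_ge_le_lintegral₀ (μ := R.P)
    (f := fun ω => (successCount R t ω i : ℝ≥0∞))
    (measurable_from_top.comp (measurable_successCount R t i)).aemeasurable (T : ℝ≥0∞)
  simp only [Nat.cast_le] at h2
  rw [h1] at h2
  refine h2.trans ?_
  rw [nodeSamples, Finset.mul_sum]
  exact Finset.sum_le_sum fun s _ => measure_success_le R s i

/-- A stationary output forces most chains to be fully explored with good probability. -/
theorem sum_mul_measure_le_of_isStationary (hm : 0 < m) (hT : 0 < T)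
    (hx : ∀ q, inner ℝ (D.v q) x₀ = 0) {ε : ℝ} {t : ℕ} {n : Fin m} (h : R.IsStationary ε t n) :
    ∑ i, (D.s i / D.r i) ^ 2 / 4 * R.P.real {ω | successCount R t ω i < T} ≤ ε ^ 2 := by
  classical
  have hmeas : ∀ i, MeasurableSet {ω | successCount R t ω i < T} := fun i =>
    measurable_successCount R t i (measurableSet_Iio (a := T))
  have key : ∀ ω, ∑ i, {ω | successCount R t ω i < T}.indicator
      (fun _ => ENNReal.ofReal ((D.s i / D.r i) ^ 2 / 4)) ω ≤
      ENNReal.ofReal (‖∇ D.problem.obj (R.out t n ω)‖ ^ 2) := by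
    intro ω
    simp only [Set.indicator_apply, Set.mem_ofPred_eq]
    rw [← Finset.sum_filter, ← ENNReal.ofReal_sum_of_nonneg fun i _ => by positivity]
    refine ENNReal.ofReal_le_ofReal (D.sum_le_sq_norm_gradient_obj hm hT _ _ fun i hi k hk => ?_)
    have hi' := (Finset.mem_filter.1 hi).2
    exact mem_subset_explored R hx ω t n (R.out_mem t n ω) i k (by omega)
  have h1 := (lintegral_mono key).trans h
  rw [lintegral_finsetSum _ fun i _ => measurable_const.indicator (hmeas i)] at h1
  simp only [lintegral_indicator_const (hmeas _)] at h1
  rw [← ENNReal.ofReal_le_ofReal_iff (sq_nonneg ε),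
    ENNReal.ofReal_sum_of_nonneg fun i _ => by positivity]
  refine le_trans (le_of_eq (Finset.sum_congr rfl fun i _ => ?_)) h1
  rw [ENNReal.ofReal_mul (by positivity), Measure.real, ENNReal.ofReal_toReal (measure_ne_top _ _)]

theorem le_expectedSamples_of_isStationary (hm : 0 < m) (hT : 0 < T)
    (hx : ∀ q, inner ℝ (D.v q) x₀ = 0) {ε : ℝ} (hε : 0 < ε) {t : ℕ} {n : Fin m}
    (h : R.IsStationary ε t n) {w : Fin m → ℝ} (hw0 : ∀ i, 0 ≤ w i) (hw : ∑ i, w i = 1)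
    (hgrad : ∀ i, 16 * w i * ε ^ 2 ≤ (D.s i / D.r i) ^ 2) {K : ℝ}
    (hK : 0 ≤ K) (hpK : ∀ i, D.p i * (w i * K) ≤ 1) :
    ENNReal.ofReal (3 / 4 * T * K) ≤ R.expectedSamples t := by
  set q : Fin m → ℝ := fun i => R.P.real {ω | successCount R t ω i < T} with hq
  have hmeas : ∀ i, MeasurableSet {ω | successCount R t ω i < T} := fun i =>
    measurable_successCount R t i (measurableSet_Iio (a := T))
  have hcompl : ∀ i, R.P.real {ω | T ≤ successCount R t ω i} = 1 - q i := by
    intro i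
    rw [hq, ← probReal_compl_eq_one_sub (hmeas i)]
    congr 1
    ext ω
    simp
  have hq1 : ∀ i, 0 ≤ 1 - q i := fun i => by rw [← hcompl]; exact measureReal_nonneg
  -- Of the factor 16, one 4 absorbs the 1/4 in the gradient bound and the other produces the 1/4
  -- here.
  have hsum : ∑ i, w i * q i ≤ 1 / 4 := by
    have h1 := sum_mul_measure_le_of_isStationary R hm hT hx h
    have h2 : ∑ i, 4 * ε ^ 2 * (w i * q i) ≤ ε ^ 2 := by
      refine (Finset.sum_le_sum fun i _ => ?_).trans h1
      calc 4 * ε ^ 2 * (w i * q i) = 16 * w i * ε ^ 2 / 4 * q i := by ring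
        _ ≤ _ := mul_le_mul_of_nonneg_right
          (div_le_div_of_nonneg_right (hgrad i) (by norm_num)) measureReal_nonneg
    rw [← Finset.mul_sum] at h2
    have hε2 : 0 < ε ^ 2 := by positivity
    nlinarith
  have hnode : ∀ i, ENNReal.ofReal (T * K * (w i * (1 - q i))) ≤ nodeSamples R t i := by
    intro i
    have h1 := mul_measure_le_nodeSamples R t i
    have hp := D.p_pos i
    have e : R.P {ω | T ≤ successCount R t ω i} = ENNReal.ofReal (1 - q i) := by
      rw [← hcompl, Measure.real, ENNReal.ofReal_toReal (measure_ne_top _ _)]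
    rw [e, ← ENNReal.ofReal_natCast, ← ENNReal.ofReal_mul (Nat.cast_nonneg T)] at h1
    have hwK : 0 ≤ w i * K := mul_nonneg (hw0 i) hK
    calc ENNReal.ofReal (T * K * (w i * (1 - q i)))
        = ENNReal.ofReal (w i * K) * ENNReal.ofReal (T * (1 - q i)) := by
          rw [← ENNReal.ofReal_mul hwK]
          ring_nf
      _ ≤ ENNReal.ofReal (w i * K) * (ENNReal.ofReal (D.p i) * nodeSamples R t i) := by gcongr
      _ = ENNReal.ofReal (D.p i * (w i * K)) * nodeSamples R t i := by
          rw [← mul_assoc, ← ENNReal.ofReal_mul hwK, mul_comm (w i * K)]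
      _ ≤ 1 * nodeSamples R t i := by
          gcongr
          exact ENNReal.ofReal_le_one.2 (hpK i)
      _ = _ := one_mul _
  rw [expectedSamples_eq]
  refine le_trans ?_ (Finset.sum_le_sum fun i _ => hnode i)
  have hTK : (0 : ℝ) ≤ T * K := by positivity
  rw [← ENNReal.ofReal_sum_of_nonneg fun i _ => mul_nonneg hTK (mul_nonneg (hw0 i) (hq1 i)),
    ← Finset.mul_sum]
  refine ENNReal.ofReal_le_ofReal ?_
  have : ∑ i, w i * (1 - q i) = 1 - ∑ i, w i * q i := by
    simp_rw [mul_sub, mul_one]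
    rw [Finset.sum_sub_distrib, hw]
  rw [this]
  nlinarith

end ChainData

/-! ### Choice of parameters and conclusion. -/

/-- One spare dimension makes room for the initial point. That point depends only on the dimension,
so the directions may be chosen after it. -/
theorem exists_orthonormal_orthogonal (ι : Type*) [Fintype ι] (x₀ : Vec (Fintype.card ι + 1)) :
    ∃ v : ι → Vec (Fintype.card ι + 1), Orthonormal ℝ v ∧ ∀ q, inner ℝ (v q) x₀ = 0 := by
  have h1 := Submodule.finrank_add_finrank_orthogonal (ℝ ∙ x₀)
  have h2 : Module.finrank ℝ (ℝ ∙ x₀) ≤ 1 :=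
    (finrank_span_le_card ({x₀} : Set (Vec (Fintype.card ι + 1)))).trans (by simp)
  rw [finrank_euclideanSpace_fin] at h1
  let b := stdOrthonormalBasis ℝ (ℝ ∙ x₀)ᗮ
  let f : ι → Fin (Module.finrank ℝ (ℝ ∙ x₀)ᗮ) :=
    fun q => Fin.castLE (by omega) (Fintype.equivFin ι q)
  have hf : Function.Injective f := fun a c h =>
    (Fintype.equivFin ι).injective (Fin.castLE_injective _ h)
  refine ⟨fun q => (b (f q) : Vec (Fintype.card ι + 1)), ?_, fun q => ?_⟩
  · exact (b.orthonormal.comp_linearIsometry (ℝ ∙ x₀)ᗮ.subtypeₗᵢ).comp f hf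
  · rw [real_inner_comm]
    exact (Submodule.mem_orthogonal_singleton_iff_inner_right.1 (b (f q)).2)

/-- A hard instance whose chain at node `i` carries the share `w i` of the optimality gap. -/
theorem exists_chainData {m T : ℕ} (hT : 0 < T) {Δ L : ℝ} (hΔ : 0 < Δ) (hL : 0 < L)
    {σ w : Fin m → ℝ} (hσ : ∀ i, 0 < σ i) (hw0 : ∀ i, 0 < w i) {d : ℕ}
    {v : Fin m × Fin T → Vec d} (hv : Orthonormal ℝ v) (hm : 0 < m) :
    ∃ D : ChainData m T d, D.v = v ∧ (∀ i, D.s i * (2 * T) = w i * Δ) ∧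
      (∀ i, 105 * D.s i = L * D.r i ^ 2) ∧
      (∀ i, (m * (D.s i / D.r i)) ^ 2 * ((D.p i)⁻¹ - 1) ≤ σ i ^ 2) ∧
      (∀ i, (D.s i / D.r i) ^ 2 = w i * (Δ * L / (210 * T))) ∧
      ∀ i, D.p i * σ i ^ 2 ≤ (m * (D.s i / D.r i)) ^ 2 := by
  have hT' : (0 : ℝ) < T := by exact_mod_cast hT
  have hm' : (0 : ℝ) < m := by exact_mod_cast hm
  set s : Fin m → ℝ := fun i => w i * Δ / (2 * T) with hs
  set r : Fin m → ℝ := fun i => Real.sqrt (105 * s i / L) with hr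
  have hs0 : ∀ i, 0 < s i := fun i => by have := hw0 i; positivity
  have hr0 : ∀ i, 0 < r i := fun i => Real.sqrt_pos.2 (by have := hs0 i; positivity)
  have hr2 : ∀ i, r i ^ 2 = 105 * s i / L := fun i =>
    Real.sq_sqrt (by have := hs0 i; positivity)
  set M : Fin m → ℝ := fun i => (m * (s i / r i)) ^ 2 with hM
  have hM0 : ∀ i, 0 < M i := fun i => by have := hs0 i; have := hr0 i; positivity
  have hσ2 : ∀ i, 0 < σ i ^ 2 := fun i => pow_pos (hσ i) 2
  -- With p = M/σ² the variance bound is σ² - M, within budget; when M ≥ σ² the cap makes the oracle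
  -- exact.
  refine ⟨⟨v, hv, s, r, fun i => min 1 (M i / σ i ^ 2), hs0, hr0,
    fun i => lt_min one_pos (div_pos (hM0 i) (hσ2 i)), fun i => min_le_left _ _⟩,
    rfl, fun i => ?_, fun i => ?_, fun i => ?_, fun i => ?_, fun i => ?_⟩
  · simp only [hs]
    field_simp
  · simp only [hr2]
    field_simp
  · show M i * ((min 1 (M i / σ i ^ 2))⁻¹ - 1) ≤ σ i ^ 2
    have := hM0 i
    have := hσ2 i
    rcases le_total 1 (M i / σ i ^ 2) with h | h
    · rw [min_eq_left h]
      simpa using (hσ2 i).le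
    · rw [min_eq_right h, inv_div, mul_sub, mul_div_cancel₀ _ (hM0 i).ne', mul_one]
      linarith
  · have := (hs0 i).ne'
    simp only [div_pow, hr2]
    field_simp
    simp only [hs]
    field_simp
    ring
  · show min 1 (M i / σ i ^ 2) * σ i ^ 2 ≤ M i
    exact (mul_le_mul_of_nonneg_right (min_le_right _ _) (hσ2 i).le).trans_eq
      (div_mul_cancel₀ _ (hσ2 i).ne')

/-- The condition on `K` ranges over all `p` because the head probabilities are fixed inside the
construction and are known only through these bounds. -/
theorem exists_hard_problem {m : ℕ} (hm : 0 < m) {G : SimpleGraph (Fin m)}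
    (A : DecentralizedAlgorithm.{u} G) {Δ L ε : ℝ} (hΔ : 0 < Δ) (hL : 0 < L) (hε : 0 < ε)
    (hsmall : ε ^ 2 ≤ 1 / 3360 * (Δ * L)) {σ w : Fin m → ℝ} (hσ : ∀ i, 0 < σ i)
    (hw0 : ∀ i, 0 < w i) (hw : ∑ i, w i = 1) {K : ℝ} (hK : 0 ≤ K)
    (hwK : ∀ i p, 0 < p → p ≤ 1 → p * σ i ^ 2 ≤ 32 * m ^ 2 * ε ^ 2 * w i → p * (w i * K) ≤ 1) :
    ∃ (d : ℕ) (Q : StochProblem m d), Q.Satisfies (A.init d) Δ L σ ∧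
      ∀ (t : ℕ) (i : Fin m), (A.run Q).IsStationary ε t i →
        ENNReal.ofReal (Δ * L * K / (8960 * ε ^ 2)) ≤ (A.run Q).expectedSamples t := by
  set y : ℝ := Δ * L / (3360 * ε ^ 2) with hy
  have hε2 : 0 < ε ^ 2 := by positivity
  have hy1 : 1 ≤ y := by
    rw [hy, one_le_div (by positivity)]
    linarith
  -- Since 3360 = 16 · 210 and y/2 ≤ T ≤ y, the ratio ΔL/(210T) lies between 16ε² and 32ε².
  set T : ℕ := ⌊y⌋₊ with hT
  have hT1 : 1 ≤ T := Nat.one_le_floor_iff _ |>.2 hy1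
  have hT1' : (1 : ℝ) ≤ T := by exact_mod_cast hT1
  have hTy : (T : ℝ) ≤ y := Nat.floor_le (by linarith)
  have hyT : y ≤ 2 * T := by linarith [Nat.lt_floor_add_one y]
  have hyε : Δ * L = y * (3360 * ε ^ 2) := by
    rw [hy]
    field_simp
  obtain ⟨v, hv, hvx⟩ := exists_orthonormal_orthogonal (Fin m × Fin T) (A.init _)
  obtain ⟨D, rfl, hs, hr, hvar, hratio, hp⟩ := exists_chainData hT1 hΔ hL hσ hw0 hv hm
  refine ⟨_, D.problem, D.satisfies hm hvx ?_ hr hvar, fun t n h => ?_⟩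
  · simp_rw [hs]
    rw [← Finset.sum_mul, hw, one_mul]
  · have hlow : 16 * ε ^ 2 ≤ Δ * L / (210 * T) := by
      rw [le_div_iff₀ (by positivity), hyε]
      nlinarith
    have hupp : Δ * L / (210 * T) ≤ 32 * ε ^ 2 := by
      rw [div_le_iff₀ (by positivity), hyε]
      nlinarith
    refine le_trans (ENNReal.ofReal_le_ofReal ?_)
      (ChainData.le_expectedSamples_of_isStationary (A.run D.problem) hm hT1 hvx hε h
        (fun i => (hw0 i).le) hw (fun i => ?_) hK fun i => ?_)
    -- Here 8960 = 3360 · 2 · 4/3: rounding costs a factor 2, and 3/4 is the explored share.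
    · rw [hyε, div_le_iff₀ (by positivity)]
      have : y * K ≤ 2 * T * K := mul_le_mul_of_nonneg_right hyT hK
      nlinarith
    · rw [hratio]
      nlinarith [hw0 i]
    · refine hwK i _ (D.p_pos i) (D.p_le_one i) ((hp i).trans ?_)
      rw [mul_pow, hratio]
      have := mul_le_mul_of_nonneg_left hupp
        (mul_nonneg (sq_nonneg (m : ℝ)) (hw0 i).le)
      linarith

theorem theorem3p1 :
    ∃ c : ℝ, 0 < c ∧ ∃ c₀ : ℝ, 0 < c₀ ∧
      ∀ (m : ℕ), 0 < m → ∀ (G : SimpleGraph (Fin m)) (A : DecentralizedAlgorithm.{u} G)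
        (Δ L : ℝ) (σ : Fin m → ℝ), 0 < Δ → 0 < L → (∀ i, 0 < σ i) →
      ∀ ε : ℝ, 0 < ε → ε ^ 2 ≤ c₀ * (Δ * L) →
        ∃ (d : ℕ) (Q : StochProblem m d), Q.Satisfies (A.init d) Δ L σ ∧
          ∀ (t : ℕ) (i : Fin m), (A.run Q).IsStationary ε t i →
            ENNReal.ofReal (c * (Δ * L * sigmaAM σ ^ 2 / ε ^ 4 + m * Δ * L / ε ^ 2)) ≤
              (A.run Q).expectedSamples t := by
  refine ⟨1 / 600000, by norm_num, 1 / 3360, by norm_num, ?_⟩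
  intro m hm G A Δ L σ hΔ hL hσ ε hε hsmall
  have hm' : (0 : ℝ) < m := by exact_mod_cast hm
  have hσAM : 0 < sigmaAM σ := by
    have : (Finset.univ : Finset (Fin m)).Nonempty := ⟨⟨0, hm⟩, Finset.mem_univ _⟩
    exact mul_pos (by positivity) (Finset.sum_pos (fun i _ => hσ i) this)
  have hΔL : 0 < Δ * L := mul_pos hΔ hL
  rcases le_total (m * ε ^ 2) (sigmaAM σ ^ 2) with hcase | hcase
  · obtain ⟨d, Q, hQ, hlow⟩ := exists_hard_problem hm A hΔ hL hε hsmall hσ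
      -- These weights equalise σ_i²/(32 m² ε² w_i²), the largest `K` that node `i` allows; the
      -- common value is the `K` below.
      (w := fun i => σ i / (m * sigmaAM σ)) (fun i => div_pos (hσ i) (by positivity))
      (by
        rw [← Finset.sum_div, sigmaAM, ← mul_assoc, mul_one_div_cancel hm'.ne', one_mul]
        refine div_self fun h0 => ?_
        rw [sigmaAM, h0, mul_zero] at hσAM
        exact hσAM.false)
      (K := sigmaAM σ ^ 2 / (32 * ε ^ 2)) (by positivity)
      (by
        intro i p _ _ h
        have hi := hσ i
        have h' : p * σ i * (m * sigmaAM σ) ≤ 32 * m ^ 2 * ε ^ 2 := by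
          refine le_of_mul_le_mul_right ?_ hi
          calc p * σ i * (m * sigmaAM σ) * σ i = p * σ i ^ 2 * (m * sigmaAM σ) := by ring
            _ ≤ 32 * m ^ 2 * ε ^ 2 * (σ i / (m * sigmaAM σ)) * (m * sigmaAM σ) := by gcongr
            _ = _ := by field_simp
        calc p * (σ i / (m * sigmaAM σ) * (sigmaAM σ ^ 2 / (32 * ε ^ 2)))
            = p * σ i * (m * sigmaAM σ) / (32 * m ^ 2 * ε ^ 2) := by field_simp
          _ ≤ 1 := (div_le_one (by positivity)).2 h')
    refine ⟨d, Q, hQ, fun t i h => (ENNReal.ofReal_le_ofReal ?_).trans (hlow t i h)⟩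
    -- Here 286720 = 32 · 8960, and 600000 exceeds twice that, as the case assumption requires.
    calc 1 / 600000 * (Δ * L * sigmaAM σ ^ 2 / ε ^ 4 + m * Δ * L / ε ^ 2)
        = Δ * L / (600000 * ε ^ 4) * (sigmaAM σ ^ 2 + m * ε ^ 2) := by field_simp
      _ ≤ Δ * L / (600000 * ε ^ 4) * (600000 / 286720 * sigmaAM σ ^ 2) := by
          gcongr
          linarith [sq_nonneg (sigmaAM σ)]
      _ = _ := by
          field_simp
          norm_num
  · obtain ⟨d, Q, hQ, hlow⟩ := exists_hard_problem hm A hΔ hL hε hsmall hσ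
      -- Noise plays no role in this case: only p ≤ 1 is used.
      (w := fun _ => 1 / (m : ℝ)) (fun i => by positivity)
      (by simp [hm'.ne']) (K := m) hm'.le
      (by
        intro i p _ hp _
        rw [one_div_mul_cancel hm'.ne', mul_one]
        exact hp)
    refine ⟨d, Q, hQ, fun t i h => (ENNReal.ofReal_le_ofReal ?_).trans (hlow t i h)⟩
    calc 1 / 600000 * (Δ * L * sigmaAM σ ^ 2 / ε ^ 4 + m * Δ * L / ε ^ 2)
        = Δ * L / (600000 * ε ^ 4) * (sigmaAM σ ^ 2 + m * ε ^ 2) := by field_simp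
      _ ≤ Δ * L / (600000 * ε ^ 4) * (600000 / 8960 * (m * ε ^ 2)) := by
          gcongr
          have : 0 < m * ε ^ 2 := by positivity
          linarith
      _ = _ := by
          field_simp
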